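/- **Setting.** Let $m\ge 1$, $[m]=\{0,\dots,m-1\}$, $\mathbb S=\{\theta\in\mathbb C:|\theta|=1\}$. A cloud is a vector $Z=(z_i)_{i\in[m]}\in\mathbb C^m$. A permutation $\pi\in S_m$ acts on vectors by $[\pi^*Z]_i=z_{\pi^{-1}(i)}$ and on tensors $T\in(\mathbb C^m)^{\otimes2}$ by $[\pi^*T]_{ij}=T_{\pi^{-1}(i)\pi^{-1}(j)}$, and channelwise on tuples of these. $\mathrm{Stab}(0)=\{\pi\in S_m:\pi(0)=0\}$, $\tau_i$ is the transposition of $0$ and $i$ ($\tau_0=\mathrm{id}$), and $Z\otimes\overline Z=(z_i\overline{z_j})_{i,j}$. Fix a continuous function $\sigma:\mathbb R\to\mathbb R$ that is not a polynomial, and put $\rho(x+\mathrm iy)=\sigma(x)+\mathrm i\,\sigma(y)$, applied entrywise. For $\eta>0$ let $\rho_{\mathbb C}(z,\eta)=\max(|z|-\eta,0)\,z/|z|$ (with value $0$ at $z=0$). A *layer* is a real-linear map plus a bias; it is $G$-equivariant if its linear part commutes with the action of $G$ and its bias is $G$-invariant. Numbers of layers and of channels are arbitrary (finite) throughout. **$\mathcal{NR}_2(m)$.**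 A weight unit $\alpha:\mathbb C^m\times\mathbb C^m\to\mathbb C$ is built as follows. The first layer is $(Z,X)\mapsto A(Z\otimes\overline Z)+B(X\otimes\overline X)$ with $\mathrm{Stab}(0)$-equivariant layers $A,B:(\mathbb C^m)^{\otimes2}\to(\mathbb C^m)^{\ell_1}$; it is followed by $\rho$, and then by finitely many (possibly no) further $\mathrm{Stab}(0)$-equivariant layers $(\mathbb C^m)^{\ell_i}\to(\mathbb C^m)^{\ell_{i+1}}$, each followed by $\rho$. Each channel of the result is summed over the $m$ points, and to the resulting vector in $\mathbb C^{\ell}$ one applies at least one fully connected layer, with $\rho$ between consecutive layers, the last layer having values in $\mathbb C$. A vector unit $\psi:\mathbb C\to\mathbb C$ is a composition of complex-linear maps $\mathbb C^{k_j}\to\mathbb C^{k_{j+1}}$ without bias ($k$ equal to $1$ at input and output) with, between consecutive maps, the nonlinearity $\rho_{\mathbb C}(\cdot,\eta)$ applied to each channel, every channel having its own $\eta>0$. $\mathcal{NR}_2(m)$ is the set of all functions $$\Psi(Z,X)=\sum_{i\in[m]}\alpha(\tau_i^*Z,\tau_i^*X)\,\psi(z_i).$$ **$\mathcal{NR}_2^+(m)$.**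 A parallel weight unit $\alpha^+:\mathbb C^m\times\mathbb C^m\to\mathbb C^m$ is built as follows. The first layer is $(Z,X)\mapsto A(Z\otimes\overline Z)+B(X\otimes\overline X)$ with $S_m$-equivariant layers $A,B:(\mathbb C^m)^{\otimes2}\to((\mathbb C^m)^{\otimes2})^{\ell_1}$; then come finitely many (possibly no) further $S_m$-equivariant layers $((\mathbb C^m)^{\otimes2})^{\ell_i}\to((\mathbb C^m)^{\otimes2})^{\ell_{i+1}}$, each preceded by $\rho$. In each channel the result $T$ is replaced by $(\sum_jT_{ij})_{i\in[m]}$. Finally one applies at least one $S_m$-equivariant layer on multivectors $(\mathbb C^m)^{k}\to(\mathbb C^m)^{k'}$, with $\rho$ between consecutive layers, the last layer having values in $\mathbb C^m$. A parallel vector unit $\psi^+:\mathbb C^m\to\mathbb C^m$ is a composition of $S_m$-equivariant complex-linear maps $(\mathbb C^m)^{k_j}\to(\mathbb C^m)^{k_{j+1}}$ without bias ($k$ equal to $1$ at input and output) with, between consecutive maps, $\rho_{\mathbb C}(\cdot,\eta)$ applied to all entries, every channel having its own $\eta>0$. $\mathcal{NR}_2^+(m)$ is the set of all functions $$\Psi^+(Z,X)=\sum_{i\in[m]}\alpha^+(Z,X)_i\,\psi^+(Z)_i.$$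 **Theorem.** For $a>0$ let $$D_a=\{(Z,X)\in\mathbb C^m\times\mathbb C^m : a|z_i|\le|x_i|\text{ for all }i\in[m]\},$$ and let $\mathcal R_2(D_a)$ be the space of continuous functions $f:D_a\to\mathbb C$ with $$f(\theta\,\pi^*Z,\ \omega\,\pi^*X)=\theta f(Z,X)\qquad\text{for all }\theta,\omega\in\mathbb S,\ \pi\in S_m,\ (Z,X)\in D_a,$$ with the topology of uniform convergence on compact subsets of $D_a$. Then the restrictions to $D_a$ of the functions in $\mathcal{NR}_2(m)$ form a dense subset of $\mathcal R_2(D_a)$, and so do the restrictions of the functions in $\mathcal{NR}_2^+(m)$. -/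

import Mathlib

namespace ZZNet

/-- A planar point cloud with `m` points, the plane being identified with `ℂ`. -/
abbrev Cloud (m : ℕ) : Type := Fin m → ℂ

/-- The action of permutations of the points on vectors (`ι = Fin m`) and on 2-tensors
(`ι = Fin m × Fin m`, where `π • (i, j) = (π i, π j)`):
`[π^* T]_i = T_{π⁻¹ i}` and `[π^* T]_{ij} = T_{π⁻¹ i, π⁻¹ j}`. -/
def permute {m : ℕ} {ι : Type} [MulAction (Equiv.Perm (Fin m)) ι]
    (π : Equiv.Perm (Fin m)) (T : ι → ℂ) : ι → ℂ :=
  fun x => T (π⁻¹ • x)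

/-- The group of permutations that fix the point `0`. -/
def stabZero (m : ℕ) [NeZero m] : Subgroup (Equiv.Perm (Fin m)) :=
  MulAction.stabilizer (Equiv.Perm (Fin m)) (0 : Fin m)

/-- The tensor `Z ⊗ conj Z`, as a one-channel multitensor. -/
noncomputable def selfTensor {m : ℕ} (Z : Cloud m) : Fin 1 → Fin m × Fin m → ℂ :=
  fun _ ij => Z ij.1 * (starRingEnd ℂ) (Z ij.2)

/-! ### Layers -/

/-- `G`-equivariant real-linear layers with bias, from `k` channels to `l` channels. -/
def equivLayers {m : ℕ} (G : Subgroup (Equiv.Perm (Fin m))) (ι κ : Type)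
    [MulAction (Equiv.Perm (Fin m)) ι] [MulAction (Equiv.Perm (Fin m)) κ] (k l : ℕ) :
    Set ((Fin k → ι → ℂ) → (Fin l → κ → ℂ)) :=
  {B | ∃ (L : (Fin k → ι → ℂ) →ₗ[ℝ] (Fin l → κ → ℂ)) (b : Fin l → κ → ℂ),
    (∀ π ∈ G, ∀ T, L (fun c => permute π (T c)) = fun c => permute π (L T c)) ∧
    (∀ π ∈ G, (fun c => permute π (b c)) = b) ∧
    ∀ T, B T = L T + b}

/-- First layers for pairs of clouds: `(Z, X) ↦ A (Z ⊗ conj Z) + B (X ⊗ conj X)`. -/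
def pairFirstLayers {m : ℕ} (G : Subgroup (Equiv.Perm (Fin m))) (κ : Type)
    [MulAction (Equiv.Perm (Fin m)) κ] (l : ℕ) :
    Set (Cloud m × Cloud m → (Fin l → κ → ℂ)) :=
  {f | ∃ A ∈ equivLayers G (Fin m × Fin m) κ 1 l, ∃ B ∈ equivLayers G (Fin m × Fin m) κ 1 l,
    ∀ p, f p = A (selfTensor p.1) + B (selfTensor p.2)}

/-- Fully connected real-linear layers with bias. -/
def denseLayers (k l : ℕ) : Set ((Fin k → ℂ) → (Fin l → ℂ)) :=
  {B | ∃ (L : (Fin k → ℂ) →ₗ[ℝ] (Fin l → ℂ)) (b : Fin l → ℂ), ∀ v, B v = L v + b}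

/-- Fully connected complex-linear layers without bias. -/
def complexLayers (k l : ℕ) : Set ((Fin k → ℂ) → (Fin l → ℂ)) :=
  {B | ∃ L : (Fin k → ℂ) →ₗ[ℂ] (Fin l → ℂ), ∀ v, B v = L v}

/-- Complex-linear layers without bias on multivectors that are equivariant under all
permutations of the points. -/
def complexEquivLayers (m k l : ℕ) : Set ((Fin k → Fin m → ℂ) → (Fin l → Fin m → ℂ)) :=
  {B | ∃ L : (Fin k → Fin m → ℂ) →ₗ[ℂ] (Fin l → Fin m → ℂ),
    (∀ (π : Equiv.Perm (Fin m)) (T), L (fun c => permute π (T c)) = fun c => permute π (L T c)) ∧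
    ∀ T, B T = L T}

/-! ### Nonlinearities -/

/-- A real activation function, applied separately to real and imaginary parts. -/
noncomputable def splitAct (σ : ℝ → ℝ) (z : ℂ) : ℂ := ⟨σ z.re, σ z.im⟩

/-- The complex ReLU with threshold `η`. -/
noncomputable def complexReLU (η : ℝ) (z : ℂ) : ℂ :=
  ((max (‖z‖ - η) 0 : ℝ) : ℂ) * (z / (‖z‖ : ℂ))

/-- `splitAct σ`, pointwise, on multivectors or multitensors. -/
noncomputable def pointwiseAct (σ : ℝ → ℝ) {k : ℕ} {ι : Type} (T : Fin k → ι → ℂ) :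
    Fin k → ι → ℂ :=
  fun c x => splitAct σ (T c x)

/-- Networks in which layers and nonlinearities alternate, beginning with a layer in `first`
and ending with a layer; any depth and any numbers of channels are allowed. -/
inductive Alternating {E : Type} {Y : ℕ → Type} (first : ∀ l, Set (E → Y l))
    (nonlin : ∀ l, Set (Y l → Y l)) (next : ∀ k l, Set (Y k → Y l)) :
    ∀ l, (E → Y l) → Prop
  | base {l : ℕ} {f : E → Y l} (hf : f ∈ first l) : Alternating first nonlin next l f
  | step {k l : ℕ} {f : E → Y k} {r : Y k → Y k} {B : Y k → Y l}
      (hf : Alternating first nonlin next k f) (hr : r ∈ nonlin k) (hB : B ∈ next k l) :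
      Alternating first nonlin next l (fun e => B (r (f e)))

/-! ### The architecture with a distinguished point -/

/-- Two-cloud weight units.  Early layers `f`, equivariant under the stabilizer of `0`, each
followed by the nonlinearity; then summation over the points; then fully connected layers `g`. -/
def weightUnits (σ : ℝ → ℝ) (m : ℕ) [NeZero m] : Set (Cloud m × Cloud m → ℂ) :=
  {α | ∃ (l : ℕ) (f : Cloud m × Cloud m → Fin l → Fin m → ℂ) (g : (Fin l → ℂ) → Fin 1 → ℂ),
    Alternating (Y := fun l => Fin l → Fin m → ℂ)
      (pairFirstLayers (stabZero m) (Fin m)) (fun _ => {pointwiseAct σ})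
      (equivLayers (stabZero m) (Fin m) (Fin m)) l f ∧
    Alternating (Y := fun l => Fin l → ℂ)
      (denseLayers l) (fun _ => {fun v c => splitAct σ (v c)}) denseLayers 1 g ∧
    ∀ p, α p = g (fun c => ∑ i, pointwiseAct σ (f p) c i) 0}

/-- Vector units: complex-linear layers without bias in alternation with complex ReLUs, each
channel with its own threshold. -/
def vectorUnits : Set (ℂ → ℂ) :=
  {ψ | ∃ g : (Fin 1 → ℂ) → Fin 1 → ℂ,
    Alternating (Y := fun l => Fin l → ℂ) (complexLayers 1)
      (fun l => {r | ∃ η : Fin l → ℝ, (∀ c, 0 < η c) ∧ ∀ v c, r v c = complexReLU (η c) (v c)})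
      complexLayers 1 g ∧
    ∀ z, ψ z = g (fun _ => z) 0}

/-- The networks `Ψ(Z, X) = ∑ i, α(τ_i^* Z, τ_i^* X) ψ(z_i)`, where `τ_i` swaps `0` and `i`. -/
def NR₂ (σ : ℝ → ℝ) (m : ℕ) [NeZero m] : Set (Cloud m × Cloud m → ℂ) :=
  {Ψ | ∃ α ∈ weightUnits σ m, ∃ ψ ∈ vectorUnits, ∀ Z X, Ψ (Z, X) =
    ∑ i, α (permute (Equiv.swap 0 i) Z, permute (Equiv.swap 0 i) X) * ψ (Z i)}

/-! ### The parallel architecture -/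

/-- Parallel two-cloud weight units.  Early layers `f` on multitensors, equivariant under all
permutations; then summation over the second tensor index; then late layers `g` on multivectors,
equivariant under all permutations. -/
def weightUnitsPlus (σ : ℝ → ℝ) (m : ℕ) : Set (Cloud m × Cloud m → Fin m → ℂ) :=
  {α | ∃ (l : ℕ) (f : Cloud m × Cloud m → Fin l → Fin m × Fin m → ℂ)
      (g : (Fin l → Fin m → ℂ) → Fin 1 → Fin m → ℂ),
    Alternating (Y := fun l => Fin l → Fin m × Fin m → ℂ)
      (pairFirstLayers (m := m) ⊤ (Fin m × Fin m)) (fun _ => {pointwiseAct σ})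
      (equivLayers (m := m) ⊤ (Fin m × Fin m) (Fin m × Fin m)) l f ∧
    Alternating (Y := fun l => Fin l → Fin m → ℂ)
      (equivLayers (m := m) ⊤ (Fin m) (Fin m) l) (fun _ => {pointwiseAct σ})
      (equivLayers (m := m) ⊤ (Fin m) (Fin m)) 1 g ∧
    ∀ p, α p = g (fun c i => ∑ j, f p c (i, j)) 0}

/-- Parallel vector units, acting on a whole cloud. -/
def vectorUnitsPlus (m : ℕ) : Set (Cloud m → Fin m → ℂ) :=
  {ψ | ∃ g : (Fin 1 → Fin m → ℂ) → Fin 1 → Fin m → ℂ,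
    Alternating (Y := fun l => Fin l → Fin m → ℂ) (complexEquivLayers m 1)
      (fun l => {r | ∃ η : Fin l → ℝ, (∀ c, 0 < η c) ∧
        ∀ T c i, r T c i = complexReLU (η c) (T c i)})
      (complexEquivLayers m) 1 g ∧
    ∀ Z, ψ Z = g (fun _ => Z) 0}

/-- The networks `Ψ(Z, X) = ∑ i, α(Z, X)_i ψ(Z)_i`. -/
def NR₂Plus (σ : ℝ → ℝ) (m : ℕ) : Set (Cloud m × Cloud m → ℂ) :=
  {Ψ | ∃ α ∈ weightUnitsPlus σ m, ∃ ψ ∈ vectorUnitsPlus m,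
    ∀ Z X, Ψ (Z, X) = ∑ i, α (Z, X) i * ψ Z i}

/-! ### The function space -/

/-- The cloud pairs with `a |z_i| ≤ |x_i|` for all `i`. -/
def pairDomain (a : ℝ) (m : ℕ) : Set (Cloud m × Cloud m) :=
  {p | ∀ i, a * ‖p.1 i‖ ≤ ‖p.2 i‖}

/-- Rotate the two clouds by `θ` and `ω`, and permute them simultaneously by `π`. -/
def moveClouds {m : ℕ} (θ ω : Circle) (π : Equiv.Perm (Fin m)) (p : Cloud m × Cloud m) :
    Cloud m × Cloud m :=
  ((θ : ℂ) • permute π p.1, (ω : ℂ) • permute π p.2)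

theorem moveClouds_mem {a : ℝ} {m : ℕ} (θ ω : Circle) (π : Equiv.Perm (Fin m))
    {p : Cloud m × Cloud m} (hp : p ∈ pairDomain a m) :
    moveClouds θ ω π p ∈ pairDomain a m := by
  intro i
  have h := hp (π⁻¹ • i)
  simpa only [moveClouds, permute, Pi.smul_apply, smul_eq_mul, norm_mul, Circle.norm_coe,
    one_mul] using h

/-- Continuous functions on the domain that are rotation-equivariant in the first cloud,
rotation-invariant in the second one, and invariant under simultaneous permutations.
`C(_, ℂ)` carries the topology of uniform convergence on compact sets. -/
def equivFunctions (a : ℝ) (m : ℕ) : Set C(pairDomain a m, ℂ) :=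
  {f | ∀ (θ ω : Circle) (π : Equiv.Perm (Fin m)) (p : pairDomain a m),
    f ⟨moveClouds θ ω π p, moveClouds_mem θ ω π p.2⟩ = (θ : ℂ) * f p}

/-- The continuous functions on the domain that are restrictions of members of `S`. -/
def restrictions (a : ℝ) {m : ℕ} (S : Set (Cloud m × Cloud m → ℂ)) : Set C(pairDomain a m, ℂ) :=
  {f | ∃ Ψ ∈ S, ∀ p : pairDomain a m, f p = Ψ p}

/-- The members of `S`, restricted to the domain, form a dense subset of `equivFunctions a m`:
each restriction is continuous and belongs to the space, and each member of the space is a limit,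
uniformly on compact sets, of such restrictions. -/
def DenseOn (a : ℝ) {m : ℕ} (S : Set (Cloud m × Cloud m → ℂ)) : Prop :=
  (∀ Ψ ∈ S, ∃ f ∈ equivFunctions a m, ∀ p : pairDomain a m, f p = Ψ p) ∧
  equivFunctions a m ⊆ closure (restrictions a S)

end ZZNet

/-! ### Universal approximation with a nonpolynomial activation -/

section UniversalApproximation

open Filter Topology MeasureTheory Polynomial
open scoped ContDiff

/-! Both architectures are continuous and equivariant layer by layer. For density the vector unit
can be the identity, so all the work is in the weights. With energy `E = ∑ |z_i|²` and `δ > 0`, the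
weights `G_i = f · conj z_i / (E + δ)` satisfy `∑ G_i z_i = f - f δ/(E + δ)`. Since `f` vanishes
where `E = 0`, the error is uniformly small on a compact set for small `δ`.

It remains to approximate `G_i` by a network with one hidden layer before pooling and one after.
`G_i` depends only on the multiset over `j` of the features `z_i conj z_j`, `|z_i|²`, `x_i conj
x_j`, `|x_i|²`. If `z_i ≠ 0`, then `x_i ≠ 0` by `a|z_i| ≤ |x_i|`, and the features determine both
clouds up to separate rotations and a common permutation (`exists_moveClouds_of_pairFeature_eq`). If
`z_i = 0`, then `G_i = 0`. Sums of neurons over `j` determine the multiset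
(`exists_perm_of_sum_activation_eq`), and neurons in these sums approximate every continuous
function of them (`mem_closure_span_activation`).

The last result is obtained by mollifying `σ` and differentiating in the scale of a ridge `v`, which
yields all powers `v ^ k` and hence `exp v`. Exponentials of a vector space of functions span an
algebra, to which Stone–Weierstrass applies. -/

theorem exists_polynomial_of_iteratedDeriv_eq_zero (k : ℕ) {f : ℝ → ℝ} (hf : ContDiff ℝ ∞ f)
    (h : ∀ t, iteratedDeriv k f t = 0) :
    ∃ p : ℝ[X], p.degree < k ∧ ∀ t, f t = p.eval t := by
  induction k generalizing f with
  | zero => exact ⟨0, by simp, fun t => by simpa using h t⟩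
  | succ k ih =>
    obtain ⟨p, hp, hfp⟩ := ih (f := deriv f) (hf.iterate_deriv 1)
      (fun t => by rw [← iteratedDeriv_succ']; exact h t)
    -- The antiderivative of `p` without constant term; `f - q` is then constant.
    set q : ℝ[X] := ∑ i ∈ Finset.range k, C (p.coeff i / (i + 1)) * X ^ (i + 1) with hq
    have hqp : derivative q = p := by
      ext n
      simp only [hq, derivative_sum, derivative_C_mul_X_pow, finsetSum_coeff, coeff_C_mul,
        Nat.add_sub_cancel, coeff_X_pow, mul_ite, mul_one, mul_zero, Finset.sum_ite_eq,
        Finset.mem_range]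
      split_ifs with hn
      · push_cast
        have : ((n : ℝ) + 1) ≠ 0 := by positivity
        field_simp
      · exact (coeff_eq_zero_of_degree_lt (hp.trans_le (by exact_mod_cast not_lt.1 hn))).symm
    have hd : ∀ t, HasDerivAt (fun t => f t - q.eval t) 0 t := fun t => by
      have h1 := ((hf.differentiable (by simp)) t).hasDerivAt.sub (q.hasDerivAt t)
      rw [hqp, hfp, sub_self] at h1
      exact h1
    have hc := is_const_of_deriv_eq_zero (fun t => (hd t).differentiableAt) (fun t => (hd t).deriv)
    refine ⟨q + C (f 0 - q.eval 0), ?_, fun t => ?_⟩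
    · refine (degree_add_le _ _).trans_lt (max_lt ?_ ?_)
      · refine (degree_sum_le _ _).trans_lt ((Finset.sup_lt_iff ?_).2 fun i hi => ?_)
        · exact WithBot.bot_lt_coe _
        · refine (degree_C_mul_X_pow_le _ _).trans_lt ?_
          rw [Finset.mem_range] at hi
          exact_mod_cast Nat.succ_lt_succ hi
      · refine degree_C_le.trans_lt ?_
        exact_mod_cast Nat.succ_pos k
    · have := hc t 0
      simp only [eval_add, eval_C]
      linarith

/-- Because the degree bound is uniform, interpolation at the nodes `0, …, k-1` reproduces every `p
n`, and it passes to the pointwise limit. -/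
theorem exists_polynomial_of_tendsto {k : ℕ} {p : ℕ → ℝ[X]} (hp : ∀ n, (p n).degree < k)
    {f : ℝ → ℝ} (h : ∀ t, Tendsto (fun n => (p n).eval t) atTop (𝓝 (f t))) :
    ∃ q : ℝ[X], ∀ t, f t = q.eval t := by
  refine ⟨Lagrange.interpolate (Finset.range k) (fun i : ℕ => (i : ℝ)) (fun i => f i), fun t => ?_⟩
  refine tendsto_nhds_unique (h t) ?_
  have hi : ∀ n, (p n).eval t = (Lagrange.interpolate (Finset.range k) (fun i : ℕ => (i : ℝ))
      (fun i => (p n).eval (i : ℝ))).eval t := fun n => by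
    rw [← Lagrange.eq_interpolate (s := Finset.range k) (v := fun i : ℕ => (i : ℝ))
      (Nat.cast_injective.injOn) (by simpa using hp n)]
  simp only [hi, Lagrange.interpolate_apply, eval_finsetSum, eval_mul, eval_C]
  exact tendsto_finsetSum _ fun i _ => (h i).mul_const _

/-- A closed subspace is itself complete, so the integral can be formed inside it; the isometric
inclusion commutes with integrals even without integrability. -/
theorem Submodule.integral_mem_of_isClosed {E : Type*} [NormedAddCommGroup E] [NormedSpace ℝ E]
    [CompleteSpace E] {M : Submodule ℝ E} (hM : IsClosed (M : Set E)) {F : ℝ → E}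
    (hmem : ∀ y, F y ∈ M) : ∫ y, F y ∈ M := by
  have : CompleteSpace M := hM.completeSpace_coe
  let F' : ℝ → M := fun y => ⟨F y, hmem y⟩
  have h : ∫ y, M.subtypeL (F' y) = M.subtypeL (∫ y, F' y) :=
    M.subtypeₗᵢ.integral_comp_comm F'
  have h2 : ∫ y, F y = M.subtypeL (∫ y, F' y) := h
  rw [h2]
  exact (∫ y, F' y).2

variable {K : Type*} [TopologicalSpace K] [CompactSpace K]

/-- `τ ∘ v` is the `C(K, ℝ)`-valued integral of weighted translates `w y • σ (v - y)`, as evaluation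
at each point shows. -/
theorem comp_convolution_mem {M : Submodule ℝ C(K, ℝ)} (hM : IsClosed (M : Set C(K, ℝ)))
    {σ w : C(ℝ, ℝ)} (hw : HasCompactSupport w) {τ : C(ℝ, ℝ)}
    (hτ : ∀ t, τ t = ∫ y, w y * σ (t - y)) {v : C(K, ℝ)}
    (hv : ∀ b : ℝ, σ.comp (v + .const K b) ∈ M) : τ.comp v ∈ M := by
  let F : ℝ → C(K, ℝ) := fun y => w y • σ.comp (v + .const K (-y))
  have hF : Continuous F := by
    refine ContinuousMap.continuous_of_continuous_uncurry _ ?_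
    simp only [F, Function.uncurry_def, ContinuousMap.smul_apply, ContinuousMap.comp_apply,
      ContinuousMap.add_apply, ContinuousMap.const_apply]
    fun_prop
  have hFc : HasCompactSupport F := hw.smul_right
  have hint : Integrable F := hF.integrable_of_hasCompactSupport hFc
  have key : τ.comp v = ∫ y, F y := by
    ext x
    have := (ContinuousMap.evalCLM ℝ x).integral_comp_comm hint
    simp only [ContinuousMap.evalCLM_apply] at this
    rw [← this]
    simp [F, hτ, sub_eq_add_neg]
  rw [key]
  exact Submodule.integral_mem_of_isClosed hM fun y => M.smul_mem _ (hv _)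

omit [CompactSpace K] in
/-- Differentiating `a ↦ u * τ (a v + b)` inside a closed subspace. -/
theorem mul_deriv_comp_mem {M : Submodule ℝ C(K, ℝ)} (hM : IsClosed (M : Set C(K, ℝ)))
    {τ τ' : C(ℝ, ℝ)} (hτ : ∀ t, HasDerivAt τ (τ' t) t) (u v x : C(K, ℝ))
    (h : ∀ a : ℝ, u * τ.comp (x + a • v) ∈ M) : u * v * τ'.comp x ∈ M := by
  -- The difference quotient in `a`, written as an integral so that it extends continuously to `a =
  -- 0`, where it equals the desired derivative.
  let Q : ℝ → C(K, ℝ) := fun a =>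
    ⟨fun k => u k * (v k * ∫ s in (0:ℝ)..1, τ' (x k + s * (a * v k))), by
      have : Continuous fun k => ∫ s in (0:ℝ)..1, τ' (x k + s * (a * v k)) :=
        intervalIntegral.continuous_parametric_intervalIntegral_of_continuous' (by fun_prop) 0 1
      fun_prop⟩
  have hQ : Continuous Q := by
    refine ContinuousMap.continuous_of_continuous_uncurry _ ?_
    simp only [Q, Function.uncurry_def, ContinuousMap.coe_mk]
    have : Continuous fun p : ℝ × K => ∫ s in (0:ℝ)..1, τ' (x p.2 + s * (p.1 * v p.2)) :=
        intervalIntegral.continuous_parametric_intervalIntegral_of_continuous' (by fun_prop) 0 1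
    fun_prop
  have hmem : ∀ a : ℝ, a ≠ 0 → Q a ∈ M := fun a ha => by
    have : Q a = a⁻¹ • (u * τ.comp (x + a • v) - u * τ.comp (x + (0 : ℝ) • v)) := by
      ext k
      have hI : ∫ s in (0:ℝ)..1, τ' (x k + s * (a * v k)) * (a * v k)
          = τ (x k + 1 * (a * v k)) - τ (x k + 0 * (a * v k)) :=
        intervalIntegral.integral_eq_sub_of_hasDerivAt
          (f := fun s => τ (x k + s * (a * v k)))
          (fun s _ => by
            have h1 : HasDerivAt (fun s : ℝ => x k + s * (a * v k)) (a * v k) s := by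
              simpa using ((hasDerivAt_id s).mul_const (a * v k)).const_add (x k)
            exact (hτ _).comp s h1)
          (Continuous.intervalIntegrable (by fun_prop) _ _)
      rw [intervalIntegral.integral_mul_const] at hI
      simp only [one_mul, zero_mul, add_zero] at hI
      simp only [Q, ContinuousMap.coe_mk, ContinuousMap.smul_apply, ContinuousMap.sub_apply,
        ContinuousMap.mul_apply, ContinuousMap.comp_apply, ContinuousMap.add_apply, smul_eq_mul,
        zero_mul, add_zero]
      rw [← mul_sub, ← hI]
      rw [mul_comm _ (a * v k)]
      set I := ∫ s in (0:ℝ)..1, τ' (x k + s * (a * v k))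
      field_simp
    rw [this]
    exact M.smul_mem _ (M.sub_mem (h _) (h _))
  have h0 : Q 0 = u * v * τ'.comp x := by
    ext k
    simp [Q, mul_assoc]
  rw [← h0]
  have ht : Tendsto Q (𝓝[≠] 0) (𝓝 (Q 0)) := (hQ.tendsto 0).mono_left nhdsWithin_le_nhds
  exact hM.mem_of_tendsto ht (eventually_nhdsWithin_of_forall hmem)

omit [CompactSpace K] in
-- Each derivative in the scale `a` brings down one factor `v`.
theorem pow_mul_iteratedDeriv_comp_mem {M : Submodule ℝ C(K, ℝ)} (hM : IsClosed (M : Set C(K, ℝ)))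
    {τ : ℝ → ℝ} (hτ : ContDiff ℝ ∞ τ) (v : C(K, ℝ))
    (h : ∀ a b : ℝ, (⟨τ, hτ.continuous⟩ : C(ℝ, ℝ)).comp (a • v + .const K b) ∈ M) (k : ℕ) :
    ∀ a b : ℝ, v ^ k * (⟨iteratedDeriv k τ,
      hτ.continuous_iteratedDeriv k (by exact_mod_cast le_top)⟩ : C(ℝ, ℝ)).comp
      (a • v + .const K b) ∈ M := by
  induction k with
  | zero =>
    intro a b
    simpa using h a b
  | succ k ih =>
    intro a b
    rw [pow_succ]
    refine mul_deriv_comp_mem hM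
      (τ := ⟨iteratedDeriv k τ, hτ.continuous_iteratedDeriv k (by exact_mod_cast le_top)⟩)
      (fun t => ?_) _ _ _ fun c => ?_
    · simp only [ContinuousMap.coe_mk, iteratedDeriv_succ]
      exact
        ((hτ.differentiable_iteratedDeriv k (by exact_mod_cast ENat.natCast_lt_top _)) t).hasDerivAt
    · convert ih (a + c) b using 3
      rw [add_smul]
      abel

/-- If the `k`-th derivatives of all mollifications of `σ` vanished identically, these would be
polynomials of degree below `k`, and so their limit `σ` would be a polynomial. At a point `b` where
one of them is nonzero, scale `0` gives a nonzero constant times `v ^ k`. -/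
theorem pow_mem_of_comp_affine_mem {M : Submodule ℝ C(K, ℝ)} (hM : IsClosed (M : Set C(K, ℝ)))
    {σ : C(ℝ, ℝ)} (hσ : ¬ ∃ p : ℝ[X], ∀ t, σ t = p.eval t) (v : C(K, ℝ))
    (h : ∀ a b : ℝ, σ.comp (a • v + .const K b) ∈ M) (k : ℕ) : v ^ k ∈ M := by
  let φ : ℕ → ContDiffBump (0 : ℝ) := fun n =>
    ⟨1 / (2 * (n + 1)), 1 / (n + 1), by positivity, by
      rw [div_lt_div_iff₀ (by positivity) (by positivity)]; nlinarith [n.cast_nonneg (α := ℝ)]⟩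
  let τ : ℕ → ℝ → ℝ := fun n =>
    MeasureTheory.convolution ((φ n).normed volume) σ (ContinuousLinearMap.lsmul ℝ ℝ) volume
  have hτ : ∀ n, ContDiff ℝ ∞ (τ n) := fun n =>
    (φ n).hasCompactSupport_normed.contDiff_convolution_left _ (φ n).contDiff_normed
      σ.continuous.locallyIntegrable
  have hlim : ∀ t, Tendsto (fun n => τ n t) atTop (𝓝 (σ t)) := fun t =>
    ContDiffBump.convolution_tendsto_right_of_continuous
      (tendsto_one_div_add_atTop_nhds_zero_nat) σ.continuous t
  obtain ⟨n, b, hnb⟩ : ∃ n b, iteratedDeriv k (τ n) b ≠ 0 := by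
    by_contra! hzero
    choose p hp hpe using fun n =>
      exists_polynomial_of_iteratedDeriv_eq_zero k (hτ n) (hzero n)
    exact hσ (exists_polynomial_of_tendsto hp fun t => by simpa only [hpe] using hlim t)
  have hmem := pow_mul_iteratedDeriv_comp_mem hM (hτ n) v (fun a b => ?_) k 0 b
  · have : v ^ k = (iteratedDeriv k (τ n) b)⁻¹ • (v ^ k *
        (⟨iteratedDeriv k (τ n), (hτ n).continuous_iteratedDeriv k (by exact_mod_cast le_top)⟩ :
          C(ℝ, ℝ)).comp ((0 : ℝ) • v + .const K b)) := by
      ext x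
      simp
      field_simp
    rw [this]
    exact M.smul_mem _ hmem
  · refine comp_convolution_mem hM (σ := σ) (w := ⟨(φ n).normed volume, (φ n).continuous_normed⟩)
      (φ n).hasCompactSupport_normed (fun t => rfl) fun c => ?_
    convert h a (b + c) using 2
    ext x
    simp [add_assoc]

/-- Stone–Weierstrass for subalgebras that need not separate points. -/
theorem Subalgebra.mem_topologicalClosure_of_separates (A : Subalgebra ℝ C(K, ℝ)) (g : C(K, ℝ))
    (hg : ∀ x y, (∀ f ∈ A, f x = f y) → g x = g y) : g ∈ A.topologicalClosure := by
  -- Identify the points that `A` does not separate; the quotient is compact, and Hausdorff because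
  -- the descended functions separate its points.
  let r : Setoid K := ⟨fun x y => ∀ f ∈ A, f x = f y, fun _ _ _ => rfl,
    fun h f hf => (h f hf).symm, fun h h' f hf => (h f hf).trans (h' f hf)⟩
  let π : C(K, Quotient r) := ⟨Quotient.mk r, continuous_quotient_mk'⟩
  let lift : ∀ f : C(K, ℝ), (∀ x y, r x y → f x = f y) → C(Quotient r, ℝ) := fun f hf =>
    ⟨Quotient.lift f hf, f.continuous.quotient_lift hf⟩
  let B : Subalgebra ℝ C(Quotient r, ℝ) := A.comap (ContinuousMap.compRightAlgHom ℝ ℝ π)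
  have hlift : ∀ f (hf : f ∈ A), lift f (fun x y h => h f hf) ∈ B := fun f hf => by
    change (lift f _).comp π ∈ A
    exact hf
  have hsep : ∀ x y : Quotient r, x ≠ y → ∃ f ∈ B, f x ≠ f y := by
    rintro ⟨x⟩ ⟨y⟩ hxy
    have : ¬ ∀ f ∈ A, f x = f y := fun h => hxy (Quotient.sound h)
    push Not at this
    obtain ⟨f, hf, hne⟩ := this
    exact ⟨_, hlift f hf, hne⟩
  have : T2Space (Quotient r) := ⟨fun x y hxy => by
    obtain ⟨f, -, hne⟩ := hsep x y hxy
    exact separated_by_continuous f.continuous hne⟩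
  have htop := ContinuousMap.subalgebra_topologicalClosure_eq_top_of_separatesPoints B
    (fun x y hxy => by
      obtain ⟨f, hf, hne⟩ := hsep x y hxy
      exact ⟨f, ⟨f, hf, rfl⟩, hne⟩)
  have hgB : lift g hg ∈ closure (B : Set C(Quotient r, ℝ)) := by
    have : lift g hg ∈ B.topologicalClosure := htop ▸ Algebra.mem_top
    exact this
  exact map_mem_closure (f := fun f : C(Quotient r, ℝ) => f.comp π)
    (ContinuousMap.continuous_precomp π) hgB (fun f hf => hf)

/-- Universal approximation: ridge functions of a nonpolynomial activation, with ridges from a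
vector space `V` of functions that contains the constants, approximate every continuous function
that is constant where all members of `V` are. -/
theorem mem_closure_span_activation {σ : C(ℝ, ℝ)} (hσ : ¬ ∃ p : ℝ[X], ∀ t, σ t = p.eval t)
    (V : Submodule ℝ C(K, ℝ)) (hV : 1 ∈ V) (g : C(K, ℝ))
    (hg : ∀ x y, (∀ v ∈ V, v x = v y) → g x = g y) :
    g ∈ closure ((Submodule.span ℝ (σ.comp '' (V : Set C(K, ℝ))) : Submodule ℝ C(K, ℝ)) :
      Set C(K, ℝ)) := by
  set M : Submodule ℝ C(K, ℝ) :=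
    (Submodule.span ℝ (σ.comp '' (V : Set C(K, ℝ)))).topologicalClosure
  have hM : IsClosed (M : Set C(K, ℝ)) := Submodule.isClosed_topologicalClosure _
  have hpow : ∀ v ∈ V, ∀ k : ℕ, v ^ k ∈ M := fun v hv =>
    pow_mem_of_comp_affine_mem hM hσ v fun a b => by
      refine Submodule.le_topologicalClosure _ (Submodule.subset_span ⟨_, ?_, rfl⟩)
      have : ContinuousMap.const K b = b • (1 : C(K, ℝ)) := by ext; simp
      rw [this]
      exact V.add_mem (V.smul_mem _ hv) (V.smul_mem _ hV)
  have hexp : ∀ v ∈ V, NormedSpace.exp v ∈ M := fun v hv =>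
    hM.mem_of_tendsto (NormedSpace.exp_series_hasSum_exp' (𝕂 := ℝ) v)
      (Eventually.of_forall fun s => M.sum_mem fun k _ => M.smul_mem _ (hpow v hv k))
  -- Closed under products because `V` is closed under sums; hence the algebra it generates is just
  -- its linear span and lies in `M`.
  let S : Submonoid C(K, ℝ) :=
    { carrier := NormedSpace.exp '' (V : Set C(K, ℝ))
      one_mem' := ⟨0, V.zero_mem, NormedSpace.exp_zero⟩
      mul_mem' := by
        rintro _ _ ⟨v, hv, rfl⟩ ⟨w, hw, rfl⟩
        exact ⟨v + w, V.add_mem hv hw, NormedSpace.exp_add⟩ }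
  have hadj : ∀ f ∈ Algebra.adjoin ℝ (S : Set C(K, ℝ)), f ∈ M := fun f hf => by
    have h2 : f ∈ Subalgebra.toSubmodule (Algebra.adjoin ℝ (S : Set C(K, ℝ))) := hf
    rw [Algebra.adjoin_eq_span, Submonoid.closure_eq] at h2
    refine Submodule.span_le.2 ?_ h2
    rintro _ ⟨v, hv, rfl⟩
    exact hexp v hv
  have hmem := (Algebra.adjoin ℝ (S : Set C(K, ℝ))).mem_topologicalClosure_of_separates g
    fun x y hxy => hg x y fun v hv => by
      have h1 := hxy _ (Algebra.subset_adjoin ⟨v, hv, rfl⟩)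
      have h2 : ∀ z, (NormedSpace.exp v) z = Real.exp (v z) := fun z => by
        rw [Real.exp_eq_exp_ℝ]
        exact NormedSpace.map_exp (ContinuousMap.evalAlgHom ℝ ℝ z)
          (continuous_eval_const z) v
      rw [h2, h2] at h1
      exact Real.exp_injective h1
  exact hM.closure_subset_iff.2 hadj hmem

theorem exists_sum_activation_approx {σ : C(ℝ, ℝ)} (hσ : ¬ ∃ p : ℝ[X], ∀ t, σ t = p.eval t)
    (V : Submodule ℝ C(K, ℝ)) (hV : 1 ∈ V) (g : C(K, ℝ))
    (hg : ∀ x y, (∀ v ∈ V, v x = v y) → g x = g y) {ε : ℝ} (hε : 0 < ε) :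
    ∃ (n : ℕ) (c : Fin n → ℝ) (v : Fin n → C(K, ℝ)), (∀ l, v l ∈ V) ∧
      ∀ x, |g x - ∑ l, c l * σ (v l x)| < ε := by
  obtain ⟨h, hh, hd⟩ := Metric.mem_closure_iff.1 (mem_closure_span_activation hσ V hV g hg) ε hε
  obtain ⟨n, c, s, rfl⟩ := Submodule.mem_span_set'.1 hh
  choose v hv hvs using fun l => (s l).2
  refine ⟨n, c, v, hv, fun x => ?_⟩
  have := (ContinuousMap.dist_apply_le_dist x).trans_lt hd
  simpa [Real.dist_eq, ContinuousMap.sum_apply, ← hvs] using this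

theorem exists_sum_activation_approx_complex {σ : C(ℝ, ℝ)}
    (hσ : ¬ ∃ p : ℝ[X], ∀ t, σ t = p.eval t)
    (V : Submodule ℝ C(K, ℝ)) (hV : 1 ∈ V) (g : C(K, ℂ))
    (hg : ∀ x y, (∀ v ∈ V, v x = v y) → g x = g y) {ε : ℝ} (hε : 0 < ε) :
    ∃ (n : ℕ) (c : Fin n → ℂ) (v : Fin n → C(K, ℝ)), (∀ l, v l ∈ V) ∧
      ∀ x, ‖g x - ∑ l, c l * (σ (v l x) : ℂ)‖ < ε := by
  obtain ⟨n₁, c₁, v₁, hv₁, h₁⟩ := exists_sum_activation_approx hσ V hV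
    ⟨fun x => (g x).re, by fun_prop⟩ (fun x y h => congrArg Complex.re (hg x y h)) (half_pos hε)
  obtain ⟨n₂, c₂, v₂, hv₂, h₂⟩ := exists_sum_activation_approx hσ V hV
    ⟨fun x => (g x).im, by fun_prop⟩ (fun x y h => congrArg Complex.im (hg x y h)) (half_pos hε)
  refine ⟨n₁ + n₂, Fin.append (fun l => (c₁ l : ℂ)) (fun l => (c₂ l : ℂ) * Complex.I),
    Fin.append v₁ v₂, fun l => ?_, fun x => ?_⟩
  · induction l using Fin.addCases with
    | left l => simpa using hv₁ l
    | right l => simpa using hv₂ l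
  · have key : g x - ∑ l, Fin.append (fun l => (c₁ l : ℂ)) (fun l => (c₂ l : ℂ) * Complex.I) l *
        (σ (Fin.append v₁ v₂ l x) : ℂ) =
        (((g x).re - ∑ l, c₁ l * σ (v₁ l x) : ℝ) : ℂ) +
          (((g x).im - ∑ l, c₂ l * σ (v₂ l x) : ℝ) : ℂ) * Complex.I := by
      rw [Fin.sum_univ_add]
      simp only [Fin.append_left, Fin.append_right]
      conv_lhs => rw [← Complex.re_add_im (g x)]
      push_cast
      rw [sub_mul, Finset.sum_mul]
      simp only [mul_right_comm _ Complex.I]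
      ring
    rw [key]
    refine (norm_add_le _ _).trans_lt ?_
    rw [norm_mul, Complex.norm_I, mul_one, Complex.norm_real, Complex.norm_real]
    have := h₁ x
    have := h₂ x
    simp only [ContinuousMap.coe_mk, Real.norm_eq_abs] at *
    linarith

omit [TopologicalSpace K] [CompactSpace K] in
-- The functional `f ↦ ∑ f(x_j) - ∑ f(y_j)` kills all ridge functions, which are dense among
-- functions of the listed values. It therefore kills the indicator of each value, so multiplicities
-- agree and fibres can be matched.
theorem exists_perm_of_sum_activation_eq {m n : ℕ} {σ : C(ℝ, ℝ)}
    (hσ : ¬ ∃ p : ℝ[X], ∀ t, σ t = p.eval t) (x y : Fin m → Fin n → ℂ)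
    (h : ∀ (w : Fin n → ℂ) (b : ℝ),
      ∑ j, σ ((w ⬝ᵥ x j).re + b) = ∑ j, σ ((w ⬝ᵥ y j).re + b)) :
    ∃ π : Equiv.Perm (Fin m), ∀ j, y (π j) = x j := by
  classical
  suffices hcard : ∀ z, Fintype.card {j // x j = z} = Fintype.card {j // y j = z} from
    ⟨Equiv.ofFiberEquiv fun z => Fintype.equivOfCardEq (hcard z),
      fun j => Equiv.ofFiberEquiv_map _ j⟩
  intro z
  let P : Fin m ⊕ Fin m → Fin n → ℂ := Sum.elim x y
  let V : Submodule ℝ C(Fin m ⊕ Fin m, ℝ) :=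
    { carrier := {v | ∃ (w : Fin n → ℂ) (b : ℝ), ∀ t, v t = (w ⬝ᵥ P t).re + b}
      zero_mem' := ⟨0, 0, by simp⟩
      add_mem' := by
        rintro v v' ⟨w, b, hv⟩ ⟨w', b', hv'⟩
        refine ⟨w + w', b + b', fun t => ?_⟩
        simp only [ContinuousMap.add_apply, hv, hv', add_dotProduct, Complex.add_re]
        ring
      smul_mem' := by
        rintro r v ⟨w, b, hv⟩
        refine ⟨r • w, r * b, fun t => ?_⟩
        simp only [ContinuousMap.smul_apply, hv, smul_dotProduct, Complex.smul_re, smul_eq_mul]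
        ring }
  have hV : 1 ∈ V := ⟨0, 1, by simp⟩
  let g : C(Fin m ⊕ Fin m, ℝ) := ⟨fun t => if P t = z then 1 else 0, continuous_of_discreteTopology⟩
  have hg : ∀ s t, (∀ v ∈ V, v s = v t) → g s = g t := by
    intro s t hst
    suffices P s = P t by simp [g, this]
    ext k
    have key : ∀ c : ℂ, (c * P s k).re = (c * P t k).re := fun c => by
      have := hst ⟨fun t => (Pi.single k c ⬝ᵥ P t).re, continuous_of_discreteTopology⟩
        ⟨Pi.single k c, 0, by simp⟩
      simpa using this
    apply Complex.ext
    · simpa using key 1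
    · simpa using key Complex.I
  let Λ : C(Fin m ⊕ Fin m, ℝ) → ℝ := fun f => ∑ j, f (.inl j) - ∑ j, f (.inr j)
  have hΛ : Continuous Λ := by fun_prop
  have h0 : ∀ f ∈ Submodule.span ℝ (σ.comp '' (V : Set C(Fin m ⊕ Fin m, ℝ))), Λ f = 0 := by
    intro f hf
    induction hf using Submodule.span_induction with
    | mem f hf =>
      obtain ⟨v, ⟨w, b, hv⟩, rfl⟩ := hf
      simpa [Λ, hv, P, sub_eq_zero] using h w b
    | zero => simp [Λ]
    | add f f' _ _ hf hf' =>
      simp only [Λ, ContinuousMap.add_apply, Finset.sum_add_distrib] at *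
      linarith
    | smul r f _ hf =>
      simp only [Λ, ContinuousMap.smul_apply, smul_eq_mul, ← Finset.mul_sum] at *
      rw [← mul_sub, hf, mul_zero]
  have hΛg : Λ g = 0 :=
    closure_minimal h0 (isClosed_singleton.preimage hΛ) (mem_closure_span_activation hσ V hV g hg)
  have hcast : ((Fintype.card {j // x j = z} : ℕ) : ℝ) = Fintype.card {j // y j = z} := by
    rw [Fintype.card_subtype, Fintype.card_subtype, ← Finset.sum_boole, ← Finset.sum_boole]
    exact sub_eq_zero.1 hΛg
  exact_mod_cast hcast

end UniversalApproximation

open Filter Topology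

/-! ### Invariant features and approximation by shallow networks -/

namespace ZZNet
variable {m : ℕ}

/-- The rotation-invariant quantities of a pair of clouds seen from the points `i` and `j`. -/
noncomputable def pairFeature (p : Cloud m × Cloud m) (i j : Fin m) : Fin 4 → ℂ :=
  ![p.1 i * (starRingEnd ℂ) (p.1 j), p.1 i * (starRingEnd ℂ) (p.1 i),
    p.2 i * (starRingEnd ℂ) (p.2 j), p.2 i * (starRingEnd ℂ) (p.2 i)]

theorem continuous_pairFeature (i j : Fin m) :
    Continuous fun p : Cloud m × Cloud m => pairFeature p i j := by
  refine continuous_pi fun k => ?_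
  fin_cases k <;> simp [pairFeature] <;> fun_prop

/-- A real neuron evaluated on the features of the pairs `(i, j)` and summed over `j`. -/
noncomputable def pooledNeuron (σ : ℝ → ℝ) (q : (Fin 4 → ℂ) × ℝ) (p : Cloud m × Cloud m)
    (i : Fin m) : ℝ :=
  ∑ j, σ ((q.1 ⬝ᵥ pairFeature p i j).re + q.2)

/-- A network with one hidden layer before pooling and one hidden layer after it. -/
noncomputable def shallowWeight (σ : ℝ → ℝ) {N n : ℕ} (q : Fin N → (Fin 4 → ℂ) × ℝ)
    (u : Fin n → Fin N → ℝ) (d : Fin n → ℝ) (c : Fin n → ℂ) (p : Cloud m × Cloud m)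
    (i : Fin m) : ℂ :=
  ∑ l, c l * (σ (∑ k, u l k * pooledNeuron σ (q k) p i + d l) : ℂ)

/-- A nonzero reference point `z_i` fixes the rotation: `θ = z'_{i'} / z_i` has modulus one by the
equality of squared moduli, and the products with the reference point then determine all other
points. The same argument applies to the second cloud. -/
theorem exists_moveClouds_of_pairFeature_eq {a : ℝ} (ha : 0 < a) {p p' : Cloud m × Cloud m}
    (hp : p ∈ pairDomain a m) {i i' : Fin m} (hi : p.1 i ≠ 0) {π : Equiv.Perm (Fin m)}
    (h : ∀ j, pairFeature p' i' (π j) = pairFeature p i j) :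
    ∃ θ ω : Circle, p' = moveClouds θ ω π p ∧ p'.1 i' = θ * p.1 i := by
  have aux : ∀ z z' : Cloud m, z i ≠ 0 →
      (∀ j, z' i' * (starRingEnd ℂ) (z' (π j)) = z i * (starRingEnd ℂ) (z j)) →
      z' i' * (starRingEnd ℂ) (z' i') = z i * (starRingEnd ℂ) (z i) →
      ∃ θ : Circle, z' = (θ : ℂ) • permute π z ∧ z' i' = θ * z i := by
    intro z z' hz h1 h2
    have hn : ‖z' i'‖ = ‖z i‖ := by
      have h3 := congrArg norm h2
      simp only [norm_mul, RCLike.norm_conj] at h3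
      nlinarith [norm_nonneg (z' i'), norm_pos_iff.2 hz]
    have hθ : ‖z' i' / z i‖ = 1 := by
      rw [norm_div, hn, div_self (norm_ne_zero_iff.2 hz)]
    refine ⟨⟨z' i' / z i, mem_sphere_zero_iff_norm.2 hθ⟩, ?_, ?_⟩
    · have hz' : z' i' ≠ 0 := by rw [← norm_ne_zero_iff, hn]; exact norm_ne_zero_iff.2 hz
      have key : ∀ j, z' (π j) = z' i' / z i * z j := fun j => by
        have h3 := congrArg (starRingEnd ℂ) (h1 j)
        simp only [map_mul, Complex.conj_conj] at h3
        have h4 : (starRingEnd ℂ) (z i) ≠ 0 := (map_ne_zero _).2 hz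
        have h5 : (starRingEnd ℂ) (z' i') ≠ 0 := (map_ne_zero _).2 hz'
        apply mul_left_cancel₀ h5
        rw [h3]
        field_simp
        linear_combination (-z j) * h2
      funext k
      have := key (π⁻¹ k)
      simpa [permute] using this
    · exact (div_mul_cancel₀ _ hz).symm
  -- The domain condition provides a nonzero reference point in the second cloud too.
  have hx : p.2 i ≠ 0 := by
    have := hp i
    rw [← norm_pos_iff]
    exact lt_of_lt_of_le (mul_pos ha (norm_pos_iff.2 hi)) this
  obtain ⟨θ, hθ, hθi⟩ := aux p.1 p'.1 hi (fun j => by simpa [pairFeature] using congrFun (h j) 0)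
    (by simpa [pairFeature] using congrFun (h i) 1)
  obtain ⟨ω, hω, -⟩ := aux p.2 p'.2 hx (fun j => by simpa [pairFeature] using congrFun (h j) 2)
    (by simpa [pairFeature] using congrFun (h i) 3)
  exact ⟨θ, ω, Prod.ext hθ hω, hθi⟩

/-- The squared norm of the first cloud. -/
noncomputable def cloudEnergy (p : Cloud m × Cloud m) : ℝ := ∑ i, ‖p.1 i‖ ^ 2

theorem continuous_cloudEnergy : Continuous (cloudEnergy (m := m)) := by
  unfold cloudEnergy
  fun_prop

theorem cloudEnergy_nonneg (p : Cloud m × Cloud m) : 0 ≤ cloudEnergy p :=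
  Finset.sum_nonneg fun _ _ => sq_nonneg _

theorem cloudEnergy_moveClouds (θ ω : Circle) (π : Equiv.Perm (Fin m)) (p : Cloud m × Cloud m) :
    cloudEnergy (moveClouds θ ω π p) = cloudEnergy p := by
  simp only [cloudEnergy, moveClouds, permute, Pi.smul_apply, smul_eq_mul, norm_mul,
    Circle.norm_coe, one_mul]
  exact Equiv.sum_comp π⁻¹ fun i => ‖p.1 i‖ ^ 2

/-- Rotating the first cloud by `-1` fixes such a pair, so `f p = -f p`. -/
theorem eq_zero_of_cloudEnergy_eq_zero {a : ℝ} {f : C(pairDomain a m, ℂ)}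
    (hf : f ∈ equivFunctions a m) {p : pairDomain a m} (hp : cloudEnergy p.1 = 0) : f p = 0 := by
  have hz : ∀ i, p.1.1 i = 0 := fun i => by
    have := (Finset.sum_eq_zero_iff_of_nonneg fun _ _ => sq_nonneg _).1 hp i (Finset.mem_univ i)
    simpa using this
  have h1 := hf (-1) 1 1 p
  have h2 : (⟨moveClouds (-1) 1 1 p, moveClouds_mem (-1) 1 1 p.2⟩ : pairDomain a m) = p := by
    apply Subtype.ext
    refine Prod.ext ?_ ?_
    · funext i
      simp [moveClouds, permute, hz]
    · funext i
      simp [moveClouds, permute]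
  rw [h2] at h1
  have h3 : ((-1 : Circle) : ℂ) = -1 := by simp
  rw [h3] at h1
  linear_combination h1 / 2

theorem exists_shallowWeight_approx {a : ℝ} (ha : 0 < a) {σ : C(ℝ, ℝ)}
    (hσ : ¬ ∃ p : Polynomial ℝ, ∀ t, σ t = p.eval t)
    {f : C(pairDomain a m, ℂ)} (hf : f ∈ equivFunctions a m) {δ : ℝ} (hδ : 0 < δ)
    {S : Set (pairDomain a m)} (hS : IsCompact S) {ε : ℝ} (hε : 0 < ε) :
    ∃ (N n : ℕ) (q : Fin N → (Fin 4 → ℂ) × ℝ) (u : Fin n → Fin N → ℝ) (d : Fin n → ℝ)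
      (c : Fin n → ℂ), ∀ p ∈ S, ∀ i,
      ‖f p * (starRingEnd ℂ) (p.1.1 i) / (cloudEnergy p.1 + δ : ℝ) -
        shallowWeight σ q u d c p.1 i‖ < ε := by
  have : CompactSpace S := isCompact_iff_compactSpace.1 hS
  let s : (Fin 4 → ℂ) × ℝ → C(S × Fin m, ℝ) := fun q =>
    ⟨fun t => pooledNeuron σ q t.1.1.1 t.2, by
      refine continuous_prod_of_discrete_right.2 fun i => ?_
      have h (j : Fin m) : Continuous fun p : S => pairFeature p.1.1 i j :=
        (continuous_pairFeature i j).comp (by fun_prop)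
      simp only [pooledNeuron, dotProduct]
      fun_prop⟩
  -- The constant `1` supplies the biases `d` of the layer after pooling.
  let V : Submodule ℝ C(S × Fin m, ℝ) := Submodule.span ℝ (insert 1 (Set.range s))
  let g : C(S × Fin m, ℂ) :=
    ⟨fun t => f t.1.1 * (starRingEnd ℂ) (t.1.1.1.1 t.2) / (cloudEnergy t.1.1.1 + δ : ℝ), by
      refine continuous_prod_of_discrete_right.2 fun i => ?_
      have := continuous_cloudEnergy (m := m)
      have hz : Continuous fun p : S => p.1.1.1 i :=
        (continuous_apply i).comp (continuous_fst.comp (by fun_prop))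
      change Continuous fun p : S => f p.1 * (starRingEnd ℂ) (p.1.1.1 i) /
        (cloudEnergy p.1.1 + δ : ℝ)
      refine Continuous.div (by fun_prop) (by fun_prop) fun t => ?_
      have := cloudEnergy_nonneg t.1.1
      exact_mod_cast (by positivity)⟩
  have hg : ∀ x y, (∀ v ∈ V, v x = v y) → g x = g y := by
    rintro ⟨p, i⟩ ⟨p', i'⟩ h
    obtain ⟨π, hπ⟩ := exists_perm_of_sum_activation_eq hσ (pairFeature p.1.1 i)
      (pairFeature p'.1.1 i')
      fun w b => h (s (w, b)) (Submodule.subset_span (Or.inr ⟨_, rfl⟩))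
    by_cases hi : p.1.1.1 i = 0
    · have hi' : p'.1.1.1 i' = 0 := by
        have := congrFun (hπ i) 1
        simpa [pairFeature, hi] using this
      simp [g, hi, hi']
    · obtain ⟨θ, ω, hp', hθ⟩ := exists_moveClouds_of_pairFeature_eq ha p.1.2 hi hπ
      have hfp : f p'.1 = θ * f p.1 := by
        rw [← hf θ ω π p.1]
        exact congrArg f (Subtype.ext hp')
      have hE : cloudEnergy p'.1.1 = cloudEnergy p.1.1 := by rw [hp', cloudEnergy_moveClouds]
      simp only [g, ContinuousMap.coe_mk, hfp, hθ, hE, map_mul]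
      have hθθ : (θ : ℂ) * (starRingEnd ℂ) (θ : ℂ) = 1 := by simp [Complex.mul_conj]
      congr 1
      linear_combination (-(f p.1 * (starRingEnd ℂ) (p.1.1.1 i))) * hθθ
  obtain ⟨n, c, v, hv, hε⟩ := exists_sum_activation_approx_complex hσ V
    (Submodule.subset_span (Or.inl rfl)) g hg hε
  have hrep : ∀ l, ∃ (d : ℝ) (r : ((Fin 4 → ℂ) × ℝ) →₀ ℝ),
      ∀ x, v l x = r.sum (fun q t => t * s q x) + d := fun l => by
    obtain ⟨d, z, hz, hvz⟩ := Submodule.mem_span_insert.1 (hv l)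
    obtain ⟨r, rfl⟩ := Finsupp.mem_span_range_iff_exists_finsupp.1 hz
    refine ⟨d, r, fun x => ?_⟩
    rw [hvz]
    simp [Finsupp.sum, ContinuousMap.sum_apply, add_comm]
  choose d r hr using hrep
  -- All neurons after pooling share one finite list of channels; unused ones get coefficient zero.
  let Q : Finset ((Fin 4 → ℂ) × ℝ) := Finset.univ.biUnion fun l => (r l).support
  refine ⟨Q.card, n, fun k => (Q.equivFin.symm k : (Fin 4 → ℂ) × ℝ),
    fun l k => r l (Q.equivFin.symm k), d, c, fun p hp i => ?_⟩
  have hgoal := hε (⟨p, hp⟩, i)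
  suffices h : shallowWeight σ (fun k => (Q.equivFin.symm k : (Fin 4 → ℂ) × ℝ))
      (fun l k => r l (Q.equivFin.symm k)) d c p.1 i = ∑ l, c l * (σ (v l (⟨p, hp⟩, i)) : ℂ) by
    rw [h]
    exact hgoal
  refine Finset.sum_congr rfl fun l _ => ?_
  rw [hr]
  congr 4
  rw [Equiv.sum_comp Q.equivFin.symm fun q : Q => r l q * pooledNeuron σ q p.1 i,
    Finset.sum_coe_sort Q fun q => r l q * pooledNeuron σ q p.1 i]
  symm
  exact Finsupp.sum_of_support_subset _
    (Finset.subset_biUnion_of_mem (fun l => (r l).support) (Finset.mem_univ l))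
    (fun q t => t * pooledNeuron σ q p.1 i) fun q _ => zero_mul _

/-- The density argument common to both architectures: it only needs that `𝒩` contains the shallow
networks. -/
theorem mem_closure_restrictions {a : ℝ} (ha : 0 < a) {σ : C(ℝ, ℝ)}
    (hσ : ¬ ∃ p : Polynomial ℝ, ∀ t, σ t = p.eval t) {𝒩 : Set (Cloud m × Cloud m → ℂ)}
    (hcont : ∀ Ψ ∈ 𝒩, ∃ f ∈ equivFunctions a m, ∀ p : pairDomain a m, f p = Ψ p)
    (hmem : ∀ (N n : ℕ) (q : Fin N → (Fin 4 → ℂ) × ℝ) (u : Fin n → Fin N → ℝ) (d : Fin n → ℝ)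
      (c : Fin n → ℂ), (fun p => ∑ i, shallowWeight σ q u d c p i * p.1 i) ∈ 𝒩)
    {f : C(pairDomain a m, ℂ)} (hf : f ∈ equivFunctions a m) :
    f ∈ closure (restrictions a 𝒩) := by
  have hbasis := nhds_basis_uniformity' (x := f)
    (Metric.uniformity_basis_dist.compactConvergenceUniformity (α := pairDomain a m) (β := ℂ))
  rw [mem_closure_iff_nhds_basis hbasis]
  rintro ⟨S, ε⟩ ⟨hS, hε⟩
  dsimp only at hS hε
  obtain ⟨M, hM⟩ := hS.exists_bound_of_continuousOn f.continuous.continuousOn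
  obtain ⟨R, hR⟩ := hS.exists_bound_of_continuousOn
    (f := fun p : pairDomain a m => p.1.1) (by fun_prop)
  -- The energy is positive on the compact set where `‖f‖ ≥ ε / 3`, hence bounded below there.
  obtain ⟨r, hr, hrS⟩ : ∃ r > 0, ∀ p ∈ S, ε / 3 ≤ ‖f p‖ → r ≤ cloudEnergy p.1 := by
    have hT : IsCompact (S ∩ {p | ε / 3 ≤ ‖f p‖}) :=
      hS.inter_right (isClosed_le continuous_const (by fun_prop))
    have hE : ContinuousOn (fun p : pairDomain a m => cloudEnergy p.1)
        (S ∩ {p | ε / 3 ≤ ‖f p‖}) :=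
      (continuous_cloudEnergy.comp continuous_subtype_val).continuousOn
    obtain ⟨r, hr, h⟩ := hT.exists_forall_le' hE (a := 0) fun p hp => by
      refine (cloudEnergy_nonneg p.1).lt_of_ne' fun h0 => ?_
      have h1 := hp.2
      rw [Set.mem_ofPred_eq, eq_zero_of_cloudEnergy_eq_zero hf h0, norm_zero] at h1
      linarith
    exact ⟨r, hr, fun p hp h' => h p ⟨hp, h'⟩⟩
  -- `δ` makes `(|M| + 1) δ / r = ε / 3`, and `ε'` makes `m` errors of size `ε' |R|` total at most
  -- `ε / 3`. The summands `1` keep the denominators positive.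
  set δ : ℝ := r * ε / (3 * (|M| + 1)) with hδ
  have hδ0 : 0 < δ := by positivity
  set ε' : ℝ := ε / (3 * (m * |R| + 1)) with hε'
  have hε'0 : 0 < ε' := by positivity
  obtain ⟨N, n, q, u, d, c, happ⟩ := exists_shallowWeight_approx ha hσ hf hδ0 hS hε'0
  obtain ⟨g, -, hg⟩ := hcont _ (hmem N n q u d c)
  refine ⟨g, ⟨_, hmem N n q u d c, hg⟩, fun p hp => ?_⟩
  change dist (f p) (g p) < ε
  have hE := cloudEnergy_nonneg p.1
  have hEδ : ((cloudEnergy p.1 + δ : ℝ) : ℂ) ≠ 0 := by exact_mod_cast (by positivity)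
  set G : Fin m → ℂ := fun i => f p * (starRingEnd ℂ) (p.1.1 i) / (cloudEnergy p.1 + δ : ℝ)
  have hG : ∑ i, G i * p.1.1 i = f p - f p * (δ / (cloudEnergy p.1 + δ) : ℝ) := by
    have h1 : ∀ i, G i * p.1.1 i = f p / (cloudEnergy p.1 + δ : ℝ) * ((‖p.1.1 i‖ ^ 2 : ℝ) : ℂ) :=
      fun i => by
        have := Complex.conj_mul' (p.1.1 i)
        simp only [G]
        push_cast
        rw [← this]
        ring
    rw [Finset.sum_congr rfl fun i _ => h1 i, ← Finset.mul_sum, ← Complex.ofReal_sum,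
      show ∑ i, ‖p.1.1 i‖ ^ 2 = cloudEnergy p.1 from rfl]
    push_cast at hEδ ⊢
    field_simp
    ring
  have hsplit : f p - g p = f p * (δ / (cloudEnergy p.1 + δ) : ℝ) +
      ∑ i, (G i - shallowWeight σ q u d c p.1 i) * p.1.1 i := by
    simp only [sub_mul, Finset.sum_sub_distrib, hG, hg]
    ring
  have h1 : ‖f p * (δ / (cloudEnergy p.1 + δ) : ℝ)‖ ≤ ε / 3 := by
    rw [norm_mul, Complex.norm_real, Real.norm_of_nonneg (by positivity)]
    by_cases hfp : ε / 3 ≤ ‖f p‖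
    · have h2 := hrS p hp hfp
      calc ‖f p‖ * (δ / (cloudEnergy p.1 + δ)) ≤ (|M| + 1) * (δ / r) := by
            gcongr
            · exact ((hM p hp).trans (le_abs_self M)).trans (by linarith)
            · linarith
        _ = ε / 3 := by rw [hδ]; field_simp
    · have h2 : δ / (cloudEnergy p.1 + δ) ≤ 1 := by
        rw [div_le_one (by positivity)]
        linarith
      nlinarith [norm_nonneg (f p)]
  have h3 : ‖∑ i, (G i - shallowWeight σ q u d c p.1 i) * p.1.1 i‖ ≤ ε / 3 := by
    calc ‖∑ i, (G i - shallowWeight σ q u d c p.1 i) * p.1.1 i‖ ≤ ∑ _i : Fin m, ε' * |R| := by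
          refine norm_sum_le_of_le _ fun i _ => ?_
          rw [norm_mul]
          gcongr
          · exact (happ p hp i).le
          · exact ((norm_le_pi_norm _ i).trans (hR p hp)).trans (le_abs_self R)
      _ = ε' * (m * |R|) := by
          simp
          ring
      _ ≤ ε' * (m * |R| + 1) := by gcongr; linarith
      _ = ε / 3 := by rw [hε']; field_simp
  rw [dist_eq_norm, hsplit]
  refine (norm_add_le _ _).trans_lt ?_
  linarith

/-! ### Induction on depth for alternating networks -/

section Alternating
variable {E : Type} {Y : ℕ → Type} {first : ∀ l, Set (E → Y l)}
  {nonlin : ∀ l, Set (Y l → Y l)} {next : ∀ k l, Set (Y k → Y l)}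

theorem Alternating.commutes {l : ℕ} {f : E → Y l} (hf : Alternating first nonlin next l f)
    (φ : E → E) (Φ : ∀ l, Y l → Y l)
    (hfirst : ∀ l, ∀ f ∈ first l, ∀ e, f (φ e) = Φ l (f e))
    (hnonlin : ∀ l, ∀ r ∈ nonlin l, ∀ y, r (Φ l y) = Φ l (r y))
    (hnext : ∀ k l, ∀ B ∈ next k l, ∀ y, B (Φ k y) = Φ l (B y))
    (e : E) :
    f (φ e) = Φ l (f e) := by
  induction hf with
  | base hf => exact hfirst _ _ hf e
  | step _ hr hB ih => simp only [ih, hnonlin _ _ hr, hnext _ _ _ hB]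

theorem Alternating.continuous [TopologicalSpace E] [∀ l, TopologicalSpace (Y l)]
    {l : ℕ} {f : E → Y l} (hf : Alternating first nonlin next l f)
    (hfirst : ∀ l, ∀ f ∈ first l, Continuous f) (hnonlin : ∀ l, ∀ r ∈ nonlin l, Continuous r)
    (hnext : ∀ k l, ∀ B ∈ next k l, Continuous B) : Continuous f := by
  induction hf with
  | base hf => exact hfirst _ _ hf
  | step _ hr hB ih => exact (hnext _ _ _ hB).comp ((hnonlin _ _ hr).comp ih)

end Alternating


/-! ### Continuity of the networks -/

theorem continuous_of_mem_equivLayers {G : Subgroup (Equiv.Perm (Fin m))} {ι κ : Type}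
    [Fintype ι] [Fintype κ]
    [MulAction (Equiv.Perm (Fin m)) ι] [MulAction (Equiv.Perm (Fin m)) κ] {k l : ℕ}
    {B : (Fin k → ι → ℂ) → (Fin l → κ → ℂ)} (hB : B ∈ equivLayers G ι κ k l) : Continuous B := by
  obtain ⟨L, b, -, -, hB⟩ := hB
  rw [show B = fun T => L T + b from funext hB]
  exact L.continuous_of_finiteDimensional.add continuous_const

theorem continuous_selfTensor : Continuous (selfTensor (m := m)) := by
  refine continuous_pi fun _ => continuous_pi fun ij => ?_
  unfold selfTensor
  fun_prop

theorem continuous_of_mem_pairFirstLayers {G : Subgroup (Equiv.Perm (Fin m))} {κ : Type}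
    [Fintype κ] [MulAction (Equiv.Perm (Fin m)) κ] {l : ℕ}
    {f : Cloud m × Cloud m → (Fin l → κ → ℂ)} (hf : f ∈ pairFirstLayers G κ l) :
    Continuous f := by
  obtain ⟨A, hA, B, hB, hf⟩ := hf
  rw [show f = fun p => A (selfTensor p.1) + B (selfTensor p.2) from funext hf]
  exact ((continuous_of_mem_equivLayers hA).comp (continuous_selfTensor.comp continuous_fst)).add
    ((continuous_of_mem_equivLayers hB).comp (continuous_selfTensor.comp continuous_snd))

theorem continuous_of_mem_denseLayers {k l : ℕ} {B : (Fin k → ℂ) → (Fin l → ℂ)}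
    (hB : B ∈ denseLayers k l) : Continuous B := by
  obtain ⟨L, b, hB⟩ := hB
  rw [show B = fun v => L v + b from funext hB]
  exact L.continuous_of_finiteDimensional.add continuous_const

theorem continuous_of_mem_complexLayers {k l : ℕ} {B : (Fin k → ℂ) → (Fin l → ℂ)}
    (hB : B ∈ complexLayers k l) : Continuous B := by
  obtain ⟨L, hB⟩ := hB
  rw [show B = L from funext hB]
  exact L.continuous_of_finiteDimensional

theorem continuous_of_mem_complexEquivLayers {k l : ℕ}
    {B : (Fin k → Fin m → ℂ) → (Fin l → Fin m → ℂ)} (hB : B ∈ complexEquivLayers m k l) :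
    Continuous B := by
  obtain ⟨L, -, hB⟩ := hB
  rw [show B = L from funext hB]
  exact L.continuous_of_finiteDimensional

theorem continuous_splitAct {σ : ℝ → ℝ} (hσ : Continuous σ) : Continuous (splitAct σ) := by
  have : splitAct σ = fun z => (σ z.re : ℂ) + σ z.im * Complex.I := by
    funext z
    exact Complex.mk_eq_add_mul_I _ _
  rw [this]
  fun_prop

theorem continuous_pointwiseAct {σ : ℝ → ℝ} (hσ : Continuous σ) {k : ℕ} {ι : Type} :
    Continuous (pointwiseAct σ (k := k) (ι := ι)) := by
  have := continuous_splitAct hσ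
  unfold pointwiseAct
  fun_prop

theorem continuous_complexReLU {η : ℝ} (hη : 0 < η) : Continuous (complexReLU η) := by
  rw [continuous_iff_continuousAt]
  intro z
  by_cases hz : z = 0
  -- The positive threshold makes the function vanish near `0`, where `z / ‖z‖` is discontinuous.
  · have : complexReLU η =ᶠ[𝓝 z] fun _ => 0 := by
      subst hz
      filter_upwards [Metric.ball_mem_nhds (0 : ℂ) hη] with w hw
      rw [mem_ball_zero_iff] at hw
      simp [complexReLU, max_eq_right (sub_nonpos.2 hw.le)]
    exact continuousAt_const.congr this.symm
  · unfold complexReLU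
    have : (‖z‖ : ℂ) ≠ 0 := by simpa using hz
    fun_prop (disch := assumption)

theorem complexReLU_mul {η : ℝ} (θ : Circle) (z : ℂ) :
    complexReLU η (θ * z) = θ * complexReLU η z := by
  simp only [complexReLU, norm_mul, Circle.norm_coe, one_mul]
  ring

theorem continuous_of_mem_weightUnits {σ : ℝ → ℝ} (hσ : Continuous σ) [NeZero m]
    {α : Cloud m × Cloud m → ℂ} (hα : α ∈ weightUnits σ m) : Continuous α := by
  obtain ⟨l, f, g, hf, hg, hα⟩ := hα
  have hfc : Continuous f := hf.continuous (fun _ _ => continuous_of_mem_pairFirstLayers)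
    (fun _ r hr => by rw [Set.mem_singleton_iff.1 hr]; exact continuous_pointwiseAct hσ)
    (fun _ _ _ => continuous_of_mem_equivLayers)
  have hgc : Continuous g := hg.continuous (fun _ _ => continuous_of_mem_denseLayers)
    (fun _ r hr => by
      rw [Set.mem_singleton_iff.1 hr]
      have := continuous_splitAct hσ
      fun_prop)
    (fun _ _ _ => continuous_of_mem_denseLayers)
  rw [funext hα]
  have := continuous_pointwiseAct hσ (k := l) (ι := Fin m)
  fun_prop

theorem continuous_of_mem_vectorUnits {ψ : ℂ → ℂ} (hψ : ψ ∈ vectorUnits) : Continuous ψ := by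
  obtain ⟨g, hg, hψ⟩ := hψ
  have hgc : Continuous g := hg.continuous (fun _ _ => continuous_of_mem_complexLayers)
    (fun l r hr => by
      obtain ⟨η, hη, hr⟩ := hr
      refine continuous_pi fun c => ?_
      have := continuous_complexReLU (hη c)
      simp only [hr]
      fun_prop)
    (fun _ _ _ => continuous_of_mem_complexLayers)
  rw [funext hψ]
  fun_prop

theorem continuous_of_mem_weightUnitsPlus {σ : ℝ → ℝ} (hσ : Continuous σ)
    {α : Cloud m × Cloud m → Fin m → ℂ} (hα : α ∈ weightUnitsPlus σ m) : Continuous α := by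
  obtain ⟨l, f, g, hf, hg, hα⟩ := hα
  have hfc : Continuous f := hf.continuous (fun _ _ => continuous_of_mem_pairFirstLayers)
    (fun _ r hr => by rw [Set.mem_singleton_iff.1 hr]; exact continuous_pointwiseAct hσ)
    (fun _ _ _ => continuous_of_mem_equivLayers)
  have hgc : Continuous g := hg.continuous (fun _ _ => continuous_of_mem_equivLayers)
    (fun _ r hr => by rw [Set.mem_singleton_iff.1 hr]; exact continuous_pointwiseAct hσ)
    (fun _ _ _ => continuous_of_mem_equivLayers)
  rw [funext hα]
  fun_prop

theorem continuous_of_mem_vectorUnitsPlus {ψ : Cloud m → Fin m → ℂ}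
    (hψ : ψ ∈ vectorUnitsPlus m) : Continuous ψ := by
  obtain ⟨g, hg, hψ⟩ := hψ
  have hgc : Continuous g := hg.continuous (fun _ _ => continuous_of_mem_complexEquivLayers)
    (fun l r hr => by
      obtain ⟨η, hη, hr⟩ := hr
      refine continuous_pi fun c => continuous_pi fun i => ?_
      have := continuous_complexReLU (hη c)
      simp only [hr]
      fun_prop)
    (fun _ _ _ => continuous_of_mem_complexEquivLayers)
  rw [funext hψ]
  fun_prop

/-! ### Equivariance of the networks -/

theorem moveClouds_mul (θ θ' ω ω' : Circle) (π ρ : Equiv.Perm (Fin m)) (p : Cloud m × Cloud m) :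
    moveClouds (θ * θ') (ω * ω') (π * ρ) p = moveClouds θ ω π (moveClouds θ' ω' ρ p) := by
  refine Prod.ext ?_ ?_ <;> funext i <;> simp [moveClouds, permute, mul_assoc]

theorem moveClouds_one_one (π : Equiv.Perm (Fin m)) (p : Cloud m × Cloud m) :
    moveClouds 1 1 π p = (permute π p.1, permute π p.2) := by
  simp [moveClouds]

theorem selfTensor_smul_permute (θ : Circle) (π : Equiv.Perm (Fin m)) (Z : Cloud m) :
    selfTensor ((θ : ℂ) • permute π Z) = fun c => permute π (selfTensor Z c) := by
  funext c ij
  have hθ : (θ : ℂ) * (starRingEnd ℂ) (θ : ℂ) = 1 := by simp [Complex.mul_conj]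
  simp only [selfTensor, permute, Pi.smul_apply, smul_eq_mul, map_mul, Prod.smul_fst,
    Prod.smul_snd]
  linear_combination (Z (π⁻¹ • ij.1) * (starRingEnd ℂ) (Z (π⁻¹ • ij.2))) * hθ

theorem equivLayers_permute {G : Subgroup (Equiv.Perm (Fin m))} {ι κ : Type}
    [MulAction (Equiv.Perm (Fin m)) ι] [MulAction (Equiv.Perm (Fin m)) κ] {k l : ℕ}
    {B : (Fin k → ι → ℂ) → (Fin l → κ → ℂ)} (hB : B ∈ equivLayers G ι κ k l)
    {π : Equiv.Perm (Fin m)} (hπ : π ∈ G) (T : Fin k → ι → ℂ) :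
    B (fun c => permute π (T c)) = fun c => permute π (B T c) := by
  obtain ⟨L, b, hL, hb, hB⟩ := hB
  rw [hB, hB, hL π hπ]
  conv_lhs => rw [← hb π hπ]
  rfl

/-- Rotations cancel in `selfTensor`, so beyond the first layer only the permutation is visible. -/
theorem pairFirstLayers_moveClouds {G : Subgroup (Equiv.Perm (Fin m))} {κ : Type}
    [MulAction (Equiv.Perm (Fin m)) κ] {l : ℕ} {f : Cloud m × Cloud m → (Fin l → κ → ℂ)}
    (hf : f ∈ pairFirstLayers G κ l) (θ ω : Circle) {π : Equiv.Perm (Fin m)} (hπ : π ∈ G)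
    (p : Cloud m × Cloud m) : f (moveClouds θ ω π p) = fun c => permute π (f p c) := by
  obtain ⟨A, hA, B, hB, hf⟩ := hf
  rw [hf, hf]
  simp only [moveClouds, selfTensor_smul_permute]
  rw [equivLayers_permute hA hπ, equivLayers_permute hB hπ]
  rfl

theorem pairNetwork_moveClouds {G : Subgroup (Equiv.Perm (Fin m))} {κ : Type}
    [MulAction (Equiv.Perm (Fin m)) κ] {σ : ℝ → ℝ} {l : ℕ}
    {f : Cloud m × Cloud m → (Fin l → κ → ℂ)}
    (hf : Alternating (Y := fun l => Fin l → κ → ℂ) (pairFirstLayers G κ)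
      (fun _ => {pointwiseAct σ}) (equivLayers G κ κ) l f)
    (θ ω : Circle) {π : Equiv.Perm (Fin m)} (hπ : π ∈ G) (p : Cloud m × Cloud m) :
    f (moveClouds θ ω π p) = fun c => permute π (f p c) :=
  hf.commutes (moveClouds θ ω π) (fun _ T c => permute π (T c))
    (fun _ _ hf p => pairFirstLayers_moveClouds hf θ ω hπ p)
    (fun _ r hr T => by rw [Set.mem_singleton_iff.1 hr]; rfl)
    (fun _ _ _ hB T => equivLayers_permute hB hπ T) p

theorem weightUnits_moveClouds {σ : ℝ → ℝ} [NeZero m] {α : Cloud m × Cloud m → ℂ}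
    (hα : α ∈ weightUnits σ m) (θ ω : Circle) {π : Equiv.Perm (Fin m)} (hπ : π ∈ stabZero m)
    (p : Cloud m × Cloud m) : α (moveClouds θ ω π p) = α p := by
  obtain ⟨l, f, g, hf, -, hα⟩ := hα
  rw [hα, hα, pairNetwork_moveClouds hf θ ω hπ]
  congr 2
  funext c
  exact Equiv.sum_comp π⁻¹ fun i => pointwiseAct σ (f p) c i

theorem vectorUnits_mul {ψ : ℂ → ℂ} (hψ : ψ ∈ vectorUnits) (θ : Circle) (z : ℂ) :
    ψ (θ * z) = θ * ψ z := by
  obtain ⟨g, hg, hψ⟩ := hψ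
  have := hg.commutes (fun v => (θ : ℂ) • v) (fun _ v => (θ : ℂ) • v)
    (fun _ _ hB v => by obtain ⟨L, hB⟩ := hB; rw [hB, hB, map_smul])
    (fun _ r hr v => by
      obtain ⟨η, -, hr⟩ := hr
      funext c
      simp only [hr, Pi.smul_apply, smul_eq_mul, complexReLU_mul])
    (fun _ _ _ hB v => by obtain ⟨L, hB⟩ := hB; rw [hB, hB, map_smul]) (fun _ => z)
  rw [hψ, hψ]
  exact congrFun this 0

theorem weightUnitsPlus_moveClouds {σ : ℝ → ℝ} {α : Cloud m × Cloud m → Fin m → ℂ}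
    (hα : α ∈ weightUnitsPlus σ m) (θ ω : Circle) (π : Equiv.Perm (Fin m))
    (p : Cloud m × Cloud m) : α (moveClouds θ ω π p) = permute π (α p) := by
  obtain ⟨l, f, g, hf, hg, hα⟩ := hα
  have hsum : (fun c i => ∑ j, permute π (f p c) (i, j)) =
      fun c => permute π fun i => ∑ j, f p c (i, j) := by
    funext c i
    exact Equiv.sum_comp π⁻¹ fun j => f p c (π⁻¹ i, j)
  rw [hα, hα, pairNetwork_moveClouds hf θ ω (Subgroup.mem_top π), hsum]
  have := hg.commutes (fun T c => permute π (T c)) (fun _ T c => permute π (T c))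
    (fun _ _ hB T => equivLayers_permute hB (Subgroup.mem_top π) T)
    (fun _ r hr T => by rw [Set.mem_singleton_iff.1 hr]; rfl)
    (fun _ _ _ hB T => equivLayers_permute hB (Subgroup.mem_top π) T)
    (fun c i => ∑ j, f p c (i, j))
  exact congrFun this 0

theorem vectorUnitsPlus_smul_permute {ψ : Cloud m → Fin m → ℂ} (hψ : ψ ∈ vectorUnitsPlus m)
    (θ : Circle) (π : Equiv.Perm (Fin m)) (Z : Cloud m) :
    ψ ((θ : ℂ) • permute π Z) = (θ : ℂ) • permute π (ψ Z) := by
  obtain ⟨g, hg, hψ⟩ := hψ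
  have hlayer : ∀ k l, ∀ B ∈ complexEquivLayers m k l, ∀ T,
      B ((θ : ℂ) • fun c => permute π (T c)) = (θ : ℂ) • fun c => permute π (B T c) := by
    rintro k l B ⟨L, hL, hB⟩ T
    rw [hB, hB, map_smul, hL]
  have := hg.commutes (fun T => (θ : ℂ) • fun c => permute π (T c))
    (fun _ T => (θ : ℂ) • fun c => permute π (T c)) (hlayer 1)
    (fun _ r hr T => by
      obtain ⟨η, -, hr⟩ := hr
      funext c i
      simp only [hr, Pi.smul_apply, smul_eq_mul, complexReLU_mul, permute])
    hlayer (fun _ => Z)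
  rw [hψ, hψ]
  exact congrFun this 0

theorem exists_equivFunctions_of_mem_NR₂ {σ : ℝ → ℝ} (hσ : Continuous σ) [NeZero m] (a : ℝ)
    {Ψ : Cloud m × Cloud m → ℂ} (hΨ : Ψ ∈ NR₂ σ m) :
    ∃ f ∈ equivFunctions a m, ∀ p : pairDomain a m, f p = Ψ p := by
  obtain ⟨α, hα, ψ, hψ, hΨ⟩ := hΨ
  have hΨ' : Ψ = fun p => ∑ i, α (moveClouds 1 1 (Equiv.swap 0 i) p) * ψ (p.1 i) := by
    funext p
    simpa only [moveClouds_one_one] using hΨ p.1 p.2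
  have hc : Continuous Ψ := by
    have := continuous_of_mem_weightUnits hσ hα
    have := continuous_of_mem_vectorUnits hψ
    have hm : ∀ π : Equiv.Perm (Fin m), Continuous fun p : Cloud m × Cloud m =>
        moveClouds 1 1 π p := fun π => by
      unfold moveClouds permute
      fun_prop
    rw [hΨ']
    fun_prop
  refine ⟨⟨fun p => Ψ p, hc.comp continuous_subtype_val⟩, fun θ ω π p => ?_, fun _ => rfl⟩
  simp only [ContinuousMap.coe_mk, hΨ', Finset.mul_sum]
  rw [← Equiv.sum_comp π]
  refine Finset.sum_congr rfl fun j _ => ?_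
  have hz : (moveClouds θ ω π p.1).1 (π j) = θ * p.1.1 j := by simp [moveClouds, permute]
  -- `0 ↦ j ↦ π j ↦ 0`: the discrepancy between distinguishing `j` before the move and `π j` after
  -- it fixes `0`, so `α` does not see it.
  have hstab : Equiv.swap 0 (π j) * π * Equiv.swap 0 j ∈ stabZero m := by
    simp [stabZero, MulAction.mem_stabilizer_iff]
  have hmove : moveClouds 1 1 (Equiv.swap 0 (π j)) (moveClouds θ ω π p.1) =
      moveClouds θ ω (Equiv.swap 0 (π j) * π * Equiv.swap 0 j)
        (moveClouds 1 1 (Equiv.swap 0 j) p.1) := by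
    rw [← moveClouds_mul, ← moveClouds_mul, mul_assoc _ _ (Equiv.swap 0 j), Equiv.swap_mul_self]
    simp
  rw [hz, vectorUnits_mul hψ, hmove, weightUnits_moveClouds hα θ ω hstab]
  ring

theorem exists_equivFunctions_of_mem_NR₂Plus {σ : ℝ → ℝ} (hσ : Continuous σ) (a : ℝ)
    {Ψ : Cloud m × Cloud m → ℂ} (hΨ : Ψ ∈ NR₂Plus σ m) :
    ∃ f ∈ equivFunctions a m, ∀ p : pairDomain a m, f p = Ψ p := by
  obtain ⟨α, hα, ψ, hψ, hΨ⟩ := hΨ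
  have hΨ' : Ψ = fun p => ∑ i, α p i * ψ p.1 i := funext fun p => hΨ p.1 p.2
  have hc : Continuous Ψ := by
    have := continuous_of_mem_weightUnitsPlus hσ hα
    have := continuous_of_mem_vectorUnitsPlus hψ
    rw [hΨ']
    fun_prop
  refine ⟨⟨fun p => Ψ p, hc.comp continuous_subtype_val⟩, fun θ ω π p => ?_, fun _ => rfl⟩
  simp only [ContinuousMap.coe_mk, hΨ', Finset.mul_sum]
  rw [← Equiv.sum_comp π]
  refine Finset.sum_congr rfl fun j _ => ?_
  have hz : (moveClouds θ ω π p.1).1 = (θ : ℂ) • permute π p.1.1 := rfl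
  rw [hz, weightUnitsPlus_moveClouds hα, vectorUnitsPlus_smul_permute hψ]
  simp [permute]
  ring

/-! ### Shallow networks belong to both architectures -/

theorem pairFeature_moveClouds (π : Equiv.Perm (Fin m)) (p : Cloud m × Cloud m) (i j : Fin m) :
    pairFeature (moveClouds 1 1 π p) (π i) (π j) = pairFeature p i j := by
  simp [pairFeature, moveClouds, permute]

/-- Applied to the swap of `0` and `i`, this turns the weight at `i` into the weight at the
distinguished point. -/
theorem shallowWeight_moveClouds (σ : ℝ → ℝ) {N n : ℕ} (q : Fin N → (Fin 4 → ℂ) × ℝ)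
    (u : Fin n → Fin N → ℝ) (d : Fin n → ℝ) (c : Fin n → ℂ) (π : Equiv.Perm (Fin m))
    (p : Cloud m × Cloud m) (i : Fin m) :
    shallowWeight σ q u d c (moveClouds 1 1 π p) (π i) = shallowWeight σ q u d c p i := by
  have h : ∀ q, pooledNeuron σ q (moveClouds 1 1 π p) (π i) = pooledNeuron σ q p i := fun q => by
    unfold pooledNeuron
    rw [← Equiv.sum_comp π]
    simp only [pairFeature_moveClouds]
  simp only [shallowWeight, h]

theorem equivLayers_real {G : Subgroup (Equiv.Perm (Fin m))} {ι κ : Type}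
    [MulAction (Equiv.Perm (Fin m)) ι] [MulAction (Equiv.Perm (Fin m)) κ] {k l : ℕ}
    (L : (Fin k → ι → ℂ) →ₗ[ℝ] (Fin l → κ → ℂ)) (b : Fin l → ℂ)
    (hL : ∀ π ∈ G, ∀ T, L (fun c => permute π (T c)) = fun c => permute π (L T c)) :
    (fun T c x => L T c x + b c) ∈ equivLayers G ι κ k l :=
  ⟨L, fun c _ => b c, hL, fun _ _ => rfl, fun _ => rfl⟩

/-- The channelwise real-linear map `T ↦ Re (w T_s + w' T_t)`, the indices `s`, `t` depending on
the output index. -/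
noncomputable def gatherRe {ι κ : Type} {l : ℕ} (w w' : Fin l → ℂ) (s t : κ → ι) :
    (Fin 1 → ι → ℂ) →ₗ[ℝ] (Fin l → κ → ℂ) where
  toFun T c x := ((w c * T 0 (s x) + w' c * T 0 (t x)).re : ℂ)
  map_add' T T' := by
    funext c x
    simp only [Pi.add_apply, mul_add, Complex.add_re, Complex.ofReal_add]
    ring
  map_smul' r T := by
    funext c x
    simp
    ring

/-- Serves both architectures: `i = 0`, `j = id` for the distinguished point, and the two
projections for tensors. The first two features come from `Z`, the last two from `X`; the whole bias
is put on the `Z` layer. -/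
theorem gather_mem_pairFirstLayers {G : Subgroup (Equiv.Perm (Fin m))} {κ : Type}
    [MulAction (Equiv.Perm (Fin m)) κ] {N : ℕ} (q : Fin N → (Fin 4 → ℂ) × ℝ) (i j : κ → Fin m)
    (hi : ∀ π ∈ G, ∀ x, i (π⁻¹ • x) = π⁻¹ • i x) (hj : ∀ π ∈ G, ∀ x, j (π⁻¹ • x) = π⁻¹ • j x) :
    (fun p k x => ((((q k).1 ⬝ᵥ pairFeature p (i x) (j x)).re + (q k).2 : ℝ) : ℂ)) ∈
      pairFirstLayers G κ N := by
  have hL : ∀ w w' : Fin N → ℂ, ∀ π ∈ G, ∀ T,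
      gatherRe w w' (fun x => (i x, j x)) (fun x => (i x, i x)) (fun c => permute π (T c)) =
        fun c => permute π (gatherRe w w' (fun x => (i x, j x)) (fun x => (i x, i x)) T c) := by
    intro w w' π hπ T
    funext c x
    simp [gatherRe, permute, hi π hπ, hj π hπ]
  refine ⟨_, equivLayers_real (gatherRe (fun k => (q k).1 0) (fun k => (q k).1 1) _ _)
    (fun k => ((q k).2 : ℂ)) (hL _ _),
    _, equivLayers_real (gatherRe (fun k => (q k).1 2) (fun k => (q k).1 3) _ _)
    (fun _ => 0) (hL _ _), fun p => ?_⟩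
  funext k x
  simp [gatherRe, dotProduct, Fin.sum_univ_four, pairFeature, selfTensor]
  ring

/-- The real-linear map that takes real parts and combines the channels with complex weights. -/
noncomputable def mixRe {k l : ℕ} (u : Fin l → Fin k → ℂ) (ι : Type) :
    (Fin k → ι → ℂ) →ₗ[ℝ] (Fin l → ι → ℂ) where
  toFun T c x := ∑ k, u c k * ((T k x).re : ℂ)
  map_add' T T' := by
    funext c x
    simp [mul_add, Finset.sum_add_distrib]
  map_smul' r T := by
    funext c x
    simp [Finset.mul_sum, mul_left_comm]

/-- Real parts are taken because `splitAct σ` sends a real `t` to `σ t + i σ 0`, whose imaginary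
part must be discarded. -/
theorem mix_mem_equivLayers {G : Subgroup (Equiv.Perm (Fin m))} {ι : Type}
    [MulAction (Equiv.Perm (Fin m)) ι] {k l : ℕ} (u : Fin l → Fin k → ℂ) (d : Fin l → ℂ) :
    (fun T c x => ∑ k, u c k * ((T k x).re : ℂ) + d c) ∈ equivLayers G ι ι k l :=
  equivLayers_real (mixRe u ι) d fun _ _ _ => rfl

theorem mix_mem_denseLayers {k l : ℕ} (u : Fin l → Fin k → ℂ) (d : Fin l → ℂ) :
    (fun v c => ∑ k, u c k * ((v k).re : ℂ) + d c) ∈ denseLayers k l := by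
  let e : (Fin k → ℂ) →ₗ[ℝ] (Fin k → Unit → ℂ) :=
    { toFun := fun v c _ => v c, map_add' := fun _ _ => rfl, map_smul' := fun _ _ => rfl }
  let e' : (Fin l → Unit → ℂ) →ₗ[ℝ] (Fin l → ℂ) :=
    { toFun := fun v c => v c (), map_add' := fun _ _ => rfl, map_smul' := fun _ _ => rfl }
  exact ⟨e' ∘ₗ mixRe u Unit ∘ₗ e, d, fun v => rfl⟩

theorem id_mem_vectorUnits : id ∈ vectorUnits :=
  ⟨id, .base ⟨LinearMap.id, fun _ => rfl⟩, fun _ => rfl⟩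

theorem id_mem_vectorUnitsPlus : id ∈ vectorUnitsPlus m :=
  ⟨id, .base ⟨LinearMap.id, fun _ _ => rfl, fun _ => rfl⟩, fun _ => rfl⟩

theorem shallowWeight_mem_weightUnits (σ : ℝ → ℝ) [NeZero m] {N n : ℕ}
    (q : Fin N → (Fin 4 → ℂ) × ℝ) (u : Fin n → Fin N → ℝ) (d : Fin n → ℝ) (c : Fin n → ℂ) :
    (fun p => shallowWeight σ q u d c p 0) ∈ weightUnits σ m := by
  refine ⟨N, _, _, .base (gather_mem_pairFirstLayers q (fun _ => 0) (fun j => j) ?_ ?_),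
    .step (.base (mix_mem_denseLayers (fun l k => (u l k : ℂ)) fun l => (d l : ℂ)))
      (Set.mem_singleton _) (mix_mem_denseLayers (fun _ => c) fun _ => 0), fun p => ?_⟩
  · intro π hπ _
    exact ((stabZero m).inv_mem hπ).symm
  · intro π _ _
    rfl
  · simp only [shallowWeight, pooledNeuron, pointwiseAct, splitAct, add_zero, Complex.re_sum,
      Complex.add_re, Complex.ofReal_re, Complex.re_ofReal_mul]

theorem shallowWeight_mem_weightUnitsPlus (σ : ℝ → ℝ) {N n : ℕ}
    (q : Fin N → (Fin 4 → ℂ) × ℝ) (u : Fin n → Fin N → ℝ) (d : Fin n → ℝ) (c : Fin n → ℂ) :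
    (fun p i => shallowWeight σ q u d c p i) ∈ weightUnitsPlus σ m := by
  refine ⟨N, _, _,
    .step (.base (gather_mem_pairFirstLayers q Prod.fst Prod.snd (fun _ _ _ => rfl)
      fun _ _ _ => rfl)) (Set.mem_singleton _)
      -- Here pooling follows a layer rather than an activation, so an identity layer is appended
      -- after `σ`.
      (B := id) ⟨LinearMap.id, 0, fun _ _ _ => rfl, fun _ _ => rfl, fun _ => (add_zero _).symm⟩,
    .step (.base (mix_mem_equivLayers (fun l k => (u l k : ℂ)) fun l => (d l : ℂ)))
      (Set.mem_singleton _) (mix_mem_equivLayers (fun _ => c) fun _ => 0), fun p => ?_⟩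
  funext i
  simp only [shallowWeight, pooledNeuron, pointwiseAct, splitAct, add_zero, Complex.re_sum,
    Complex.add_re, Complex.ofReal_re, Complex.re_ofReal_mul, id]

theorem shallow_mem_NR₂ (σ : ℝ → ℝ) [NeZero m] {N n : ℕ} (q : Fin N → (Fin 4 → ℂ) × ℝ)
    (u : Fin n → Fin N → ℝ) (d : Fin n → ℝ) (c : Fin n → ℂ) :
    (fun p => ∑ i, shallowWeight σ q u d c p i * p.1 i) ∈ NR₂ σ m := by
  refine ⟨_, shallowWeight_mem_weightUnits σ q u d c, id, id_mem_vectorUnits, fun Z X => ?_⟩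
  refine Finset.sum_congr rfl fun i _ => ?_
  have := shallowWeight_moveClouds σ q u d c (Equiv.swap 0 i) (Z, X) i
  rw [Equiv.swap_apply_right, moveClouds_one_one] at this
  rw [← this, id]

theorem shallow_mem_NR₂Plus (σ : ℝ → ℝ) {N n : ℕ} (q : Fin N → (Fin 4 → ℂ) × ℝ)
    (u : Fin n → Fin N → ℝ) (d : Fin n → ℝ) (c : Fin n → ℂ) :
    (fun p => ∑ i, shallowWeight σ q u d c p i * p.1 i) ∈ NR₂Plus σ m :=
  ⟨_, shallowWeight_mem_weightUnitsPlus σ q u d c, id, id_mem_vectorUnitsPlus, fun _ _ => rfl⟩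

end ZZNet

theorem mainTheorem3 (m : ℕ) [NeZero m] (σ : ℝ → ℝ) (hσ : Continuous σ)
    (hσ_poly : ¬ ∃ p : Polynomial ℝ, ∀ t : ℝ, σ t = p.eval t) (a : ℝ) (ha : 0 < a) :
    ZZNet.DenseOn a (ZZNet.NR₂ σ m) ∧ ZZNet.DenseOn a (ZZNet.NR₂Plus σ m) := by
  have h₁ : ∀ Ψ ∈ ZZNet.NR₂ σ m, _ := fun _ => ZZNet.exists_equivFunctions_of_mem_NR₂ hσ a
  have h₂ : ∀ Ψ ∈ ZZNet.NR₂Plus σ m, _ :=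
    fun _ => ZZNet.exists_equivFunctions_of_mem_NR₂Plus hσ a
  exact ⟨⟨h₁, fun _ => ZZNet.mem_closure_restrictions ha (σ := ⟨σ, hσ⟩) hσ_poly h₁
      fun _ _ => ZZNet.shallow_mem_NR₂ σ⟩,
    h₂, fun _ => ZZNet.mem_closure_restrictions ha (σ := ⟨σ, hσ⟩) hσ_poly h₂
      fun _ _ => ZZNet.shallow_mem_NR₂Plus σ⟩
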